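/- Let $B$, $X$, $Y$ be complete separable metric spaces, with $X$ and $Y$ bounded (of finite diameter). Let $\pi_X\colon X\to B$ and $\pi_Y\colon Y\to B$ be $1$-Lipschitz maps, and let $\mu_X$, $\mu_Y$ be Borel probability measures on $X$, $Y$; that is, $\mathcal X=(X,d_X,\pi_X,\mu_X)$ and $\mathcal Y=(Y,d_Y,\pi_Y,\mu_Y)$ are bounded $mm$-fields over $B$. Put $$m_{X,Y}(x,y,x',y')=|d_X(x,x')-d_Y(y,y')|,\qquad d_{X,Y}(x,y)=d_B(\pi_X(x),\pi_Y(y)).$$ Let $C(\mu_X,\mu_Y)$ be the set of couplings of $\mu_X$ and $\mu_Y$ (probability measures on $X\times Y$ with marginals $\mu_X$ and $\mu_Y$), and define $$d_{GW,\infty}(\mathcal X,\mathcal Y)=\inf_{P\in C(\mu_X,\mu_Y)}\max\Big\{\tfrac12\sup_{\mathrm{supp}(P\otimes P)}m_{X,Y},\ \sup_{\mathrm{supp}\,P}d_{X,Y}\Big\}.$$ Let $U_X$ be the set of equidistributed sequences in $X$, i.e. sequences $(x_n)_{n\ge1}$ such that $\frac1n\sum_{i=1}^n\delta_{x_i}\to\mu_X$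 weakly, and define $U_Y$ in the same way for $\mu_Y$. Then $d_{GW,\infty}(\mathcal X,\mathcal Y)$ is finite and $$d_{GW,\infty}(\mathcal X,\mathcal Y)=\inf_{(x_n)\in U_X,\ (y_n)\in U_Y}\max\Big\{\tfrac12\sup_{i,j}m_{X,Y}(x_i,y_i,x_j,y_j),\ \sup_i d_{X,Y}(x_i,y_i)\Big\}.$$ Furthermore, there are sequences $(x_n)\in U_X$ and $(y_n)\in U_Y$ that realize the infimum on the right-hand side. -/

import Mathlib

open MeasureTheory Filter Topology
open scoped ENNReal

namespace MMField

variable {X Y B : Type*}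

/-- The metric distortion `m_{X,Y}(x, y, x', y') = |d_X(x, x') - d_Y(y, y')|`. -/
def distortion [MetricSpace X] [MetricSpace Y] (z z' : X × Y) : ℝ :=
  |dist z.1 z'.1 - dist z.2 z'.2|

/-- The field discrepancy `d_{X,Y}(x, y) = d_B(π_X(x), π_Y(y))`. -/
def fieldDist [MetricSpace B] (πX : X → B) (πY : Y → B) (z : X × Y) : ℝ :=
  dist (πX z.1) (πY z.2)

/-- The couplings of `μX` and `μY`: probability measures on `X × Y` with these marginals. -/
def couplings [MeasurableSpace X] [MeasurableSpace Y]
    (μX : ProbabilityMeasure X) (μY : ProbabilityMeasure Y) : Set (ProbabilityMeasure (X × Y)) :=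
  {P | (P : Measure (X × Y)).map Prod.fst = (μX : Measure X) ∧
    (P : Measure (X × Y)).map Prod.snd = (μY : Measure Y)}

/-- The `L^∞` cost of a coupling `P`: the maximum of one half of the supremum of `m_{X,Y}` over
`supp (P ⊗ P)` and the supremum of `d_{X,Y}` over `supp P`. Suprema are taken in `[0, ∞]`. -/
noncomputable def couplingCost [MetricSpace X] [MeasurableSpace X] [MetricSpace Y]
    [MeasurableSpace Y] [MetricSpace B] (πX : X → B) (πY : Y → B)
    (P : ProbabilityMeasure (X × Y)) : ℝ≥0∞ :=
  max
    ((1 / 2) * ⨆ w ∈ ((P : Measure (X × Y)).prod (P : Measure (X × Y))).support,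
      ENNReal.ofReal (distortion w.1 w.2))
    (⨆ z ∈ (P : Measure (X × Y)).support, ENNReal.ofReal (fieldDist πX πY z))

/-- The Gromov-Wasserstein distance `d_{GW,∞}` between the fields `(X, B, πX, μX)` and
`(Y, B, πY, μY)`. -/
noncomputable def gwInfDist [MetricSpace X] [MeasurableSpace X] [MetricSpace Y]
    [MeasurableSpace Y] [MetricSpace B] (πX : X → B) (πY : Y → B)
    (μX : ProbabilityMeasure X) (μY : ProbabilityMeasure Y) : ℝ≥0∞ :=
  ⨅ P ∈ couplings μX μY, couplingCost πX πY P

/-- The empirical measure of the first `n + 1` terms of the sequence `x`. -/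
noncomputable def empiricalMeasure [MeasurableSpace X] (x : ℕ → X) (n : ℕ) : Measure X :=
  ((n + 1 : ℕ) : ℝ≥0∞)⁻¹ • ∑ i ∈ Finset.range (n + 1), Measure.dirac (x i)

theorem isProbabilityMeasure_empiricalMeasure [MeasurableSpace X] (x : ℕ → X) (n : ℕ) :
    IsProbabilityMeasure (empiricalMeasure x n) := by
  constructor
  simp only [empiricalMeasure, Measure.smul_apply, Measure.finsetSum_apply, measure_univ,
    Finset.sum_const, Finset.card_range, nsmul_eq_mul, mul_one, smul_eq_mul]
  exact ENNReal.inv_mul_cancel (by simp) (ENNReal.natCast_ne_top _)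

/-- The empirical measure as an element of the space of probability measures. -/
noncomputable def empirical [MeasurableSpace X] (x : ℕ → X) (n : ℕ) : ProbabilityMeasure X :=
  ⟨empiricalMeasure x n, isProbabilityMeasure_empiricalMeasure x n⟩

/-- The set of `μ`-equidistributed (uniformly distributed) sequences: those whose empirical
measures converge weakly to `μ`. -/
def equidistributed [MetricSpace X] [MeasurableSpace X] [BorelSpace X]
    (μ : ProbabilityMeasure X) : Set (ℕ → X) :=
  {x | Tendsto (empirical x) atTop (𝓝 μ)}

/-- The cost of a pair of sequences: the maximum of one half of `sup_{i,j} m_{X,Y}` and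
`sup_i d_{X,Y}`, both in `[0, ∞]`. -/
noncomputable def sequenceCost [MetricSpace X] [MetricSpace Y] [MetricSpace B]
    (πX : X → B) (πY : Y → B) (x : ℕ → X) (y : ℕ → Y) : ℝ≥0∞ :=
  max
    ((1 / 2) * ⨆ (i : ℕ) (j : ℕ), ENNReal.ofReal (distortion (x i, y i) (x j, y j)))
    (⨆ i : ℕ, ENNReal.ofReal (fieldDist πX πY (x i, y i)))

end MMField

/-! A bound on the cost of a coupling `P` only says that points and pairs of points of supp `P`
satisfy closed conditions, because supp(`P` ⊗ `P`) is the square of supp `P`. From couplings to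
sequences: an independent sample of `P` almost surely equidistributes and stays in supp `P`
(`exists_mem_equidistributed_forall_mem_support`), so its coordinates are equidistributed and cost
no more than `P`. From sequences to couplings: empirical measures of the pairs `(x i, y i)` are
tight, since their marginals converge. A subsequential limit is a coupling, and
`lowerSemicontinuous_couplingCost` passes the bound to it. The infimum over sequences is attained
because an optimal coupling exists: the cost is lower semicontinuous and couplings form a compact
set (`isCompact_couplings`). -/

namespace MMField

/-! ### Supports and weak convergence -/

section Support

variable {Z : Type*} [MetricSpace Z] [MeasurableSpace Z]

theorem mk_mem_support_prod_self_iff (P : Measure Z) [IsProbabilityMeasure P] (z z' : Z) :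
    (z, z') ∈ (P.prod P).support ↔ z ∈ P.support ∧ z' ∈ P.support := by
  simp only [Measure.mem_support_iff_forall]
  constructor
  · refine fun h ↦ ⟨fun U hU ↦ ?_, fun U hU ↦ ?_⟩
    · have := h (U ×ˢ Set.univ) (prod_mem_nhds hU univ_mem)
      rwa [Measure.prod_prod, measure_univ, mul_one] at this
    · have := h (Set.univ ×ˢ U) (prod_mem_nhds univ_mem hU)
      rwa [Measure.prod_prod, measure_univ, one_mul] at this
  · rintro ⟨h, h'⟩ W hW
    obtain ⟨U, hU, V, hV, hUV⟩ := mem_nhds_prod_iff.1 hW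
    refine lt_of_lt_of_le ?_ (measure_mono hUV)
    rw [Measure.prod_prod]
    exact ENNReal.mul_pos (h U hU).ne' (h' V hV).ne'

/-- Portmanteau: the mass of an open set is lower semicontinuous under weak convergence. -/
theorem eventually_pos_of_isOpen [BorelSpace Z] {P : ProbabilityMeasure Z} {U : Set Z}
    (hU : IsOpen U) (h : 0 < (P : Measure Z) U) : ∀ᶠ Q : ProbabilityMeasure Z in 𝓝 P, 0 < (Q : Measure Z) U :=
  eventually_lt_of_lt_liminf
    (h.trans_le (ProbabilityMeasure.le_liminf_measure_open_of_tendsto tendsto_id hU))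

/-- Having the square of the support contained in a given closed set is a closed condition. -/
theorem isClosed_setOf_support_prod_subset [SecondCountableTopology Z] [BorelSpace Z]
    {C : Set (Z × Z)} (hC : IsClosed C) :
    IsClosed {P : ProbabilityMeasure Z | ∀ z ∈ (P : Measure Z).support,
      ∀ z' ∈ (P : Measure Z).support, (z, z') ∈ C} := by
  rw [← isOpen_compl_iff, isOpen_iff_mem_nhds]
  intro P hP
  simp only [Set.mem_compl_iff, Set.mem_ofPred_eq, not_forall] at hP
  obtain ⟨z, hz, z', hz', hC'⟩ := hP
  obtain ⟨U, V, hU, hV, hzU, hzV, hUV⟩ :=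
    isOpen_prod_iff.1 hC.isOpen_compl z z' hC'
  rw [Measure.mem_support_iff_forall] at hz hz'
  -- For `Q` near `P` both `U` and `V` keep positive mass, hence meet supp `Q`, which produces a
  -- pair outside `C`.
  filter_upwards [eventually_pos_of_isOpen hU (hz U (hU.mem_nhds hzU)),
    eventually_pos_of_isOpen hV (hz' V (hV.mem_nhds hzV))] with Q hQU hQV hQ
  obtain ⟨u, huU, hu⟩ := Measure.nonempty_inter_support_of_pos hQU
  obtain ⟨v, hvV, hv⟩ := Measure.nonempty_inter_support_of_pos hQV
  exact hUV (Set.mk_mem_prod huU hvV) (hQ u hu v hv)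

end Support

/-! ### Empirical measures and equidistributed sequences -/

section Empirical

variable {Z W : Type*}

theorem support_empirical_subset_range [MetricSpace Z] [MeasurableSpace Z] [BorelSpace Z]
    (z : ℕ → Z) (n : ℕ) :
    (empirical z n : Measure Z).support ⊆ Set.range z := by
  have hfin : (z '' (Finset.range (n + 1) : Set ℕ)).Finite := (Finset.finite_toSet _).image z
  refine (Measure.support_subset_of_isClosed hfin.isClosed ?_).trans (Set.image_subset_range _ _)
  rw [mem_ae_iff]
  change empiricalMeasure z n _ = 0
  rw [empiricalMeasure, Measure.smul_apply, Measure.finsetSum_apply, Finset.sum_eq_zero, smul_zero]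
  intro i hi
  rw [Measure.dirac_apply' _ hfin.isClosed.measurableSet.compl]
  simp only [Set.indicator_apply_eq_zero]
  exact fun h ↦ absurd (Set.mem_image_of_mem z (Finset.mem_coe.2 hi)) h

theorem map_empiricalMeasure [MeasurableSpace Z] [MeasurableSpace W] {f : Z → W}
    (hf : Measurable f) (z : ℕ → Z) (n : ℕ) :
    (empiricalMeasure z n).map f = empiricalMeasure (f ∘ z) n := by
  ext s hs
  simp only [empiricalMeasure, Measure.map_apply hf hs, Measure.smul_apply,
    Measure.finsetSum_apply, Measure.dirac_apply' _ hs, Measure.dirac_apply' _ (hf hs)]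
  rfl

theorem map_empirical [MeasurableSpace Z] [MeasurableSpace W] {f : Z → W}
    (hf : Measurable f) (z : ℕ → Z) (n : ℕ) :
    (empirical z n).map hf.aemeasurable = empirical (f ∘ z) n :=
  Subtype.ext (map_empiricalMeasure hf z n)

theorem comp_mem_equidistributed [MetricSpace Z] [MeasurableSpace Z] [BorelSpace Z]
    [MetricSpace W] [MeasurableSpace W] [BorelSpace W] {f : Z → W} (hf : Continuous f)
    {P : ProbabilityMeasure Z} {z : ℕ → Z} (hz : z ∈ equidistributed P) :
    f ∘ z ∈ equidistributed (P.map hf.measurable.aemeasurable) := by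
  have := ((ProbabilityMeasure.continuous_map hf).tendsto P).comp hz
  refine this.congr fun n ↦ map_empirical hf.measurable z n

theorem coe_empirical_apply [MeasurableSpace Z] (z : ℕ → Z) (n : ℕ) {s : Set Z}
    (hs : MeasurableSet s) :
    ((empirical z n s : NNReal) : ℝ) =
      (∑ i ∈ Finset.range (n + 1), s.indicator (fun _ ↦ (1 : ℝ)) (z i)) / ((n + 1 : ℕ) : ℝ) := by
  rw [← ProbabilityMeasure.measureReal_eq_coe_coeFn]
  change (empiricalMeasure z n).real s = _
  rw [Measure.real, empiricalMeasure, Measure.smul_apply, Measure.finsetSum_apply, smul_eq_mul,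
    ENNReal.toReal_mul, ENNReal.toReal_inv, ENNReal.toReal_natCast,
    ENNReal.toReal_sum (fun i _ ↦ measure_ne_top _ _), div_eq_inv_mul]
  congr 1
  refine Finset.sum_congr rfl fun i _ ↦ ?_
  by_cases h : z i ∈ s <;> simp [Measure.dirac_apply' _ hs, h]

/-- A second countable space has a countable π-system of open sets containing a basis. -/
theorem exists_countable_isPiSystem_isTopologicalBasis (Z : Type*) [TopologicalSpace Z]
    [SecondCountableTopology Z] :
    ∃ S : Set (Set Z), S.Countable ∧ IsPiSystem S ∧ (∀ s ∈ S, IsOpen s) ∧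
      ∀ u : Set Z, IsOpen u → ∀ x ∈ u, ∃ s ∈ S, s ∈ 𝓝 x ∧ s ⊆ u := by
  refine ⟨(fun f ↦ ⋂₀ f) '' {f | f.Finite ∧ f ⊆ TopologicalSpace.countableBasis Z},
    (Set.countable_ofPred_finite_subset (TopologicalSpace.countable_countableBasis Z)).image _,
    ?_, ?_, ?_⟩
  · rintro _ ⟨f, hf, rfl⟩ _ ⟨g, hg, rfl⟩ -
    exact ⟨f ∪ g, ⟨hf.1.union hg.1, Set.union_subset hf.2 hg.2⟩, Set.sInter_union f g⟩
  · rintro _ ⟨f, hf, rfl⟩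
    exact hf.1.isOpen_sInter fun t ht ↦ TopologicalSpace.isOpen_of_mem_countableBasis (hf.2 ht)
  · intro u hu x hx
    obtain ⟨s, hs, hxs, hsu⟩ :=
      (TopologicalSpace.isBasis_countableBasis Z).exists_subset_of_mem_open hx hu
    exact ⟨s, ⟨{s}, ⟨Set.finite_singleton s, Set.singleton_subset_iff.2 hs⟩, Set.sInter_singleton s⟩,
      (TopologicalSpace.isOpen_of_mem_countableBasis hs).mem_nhds hxs, hsu⟩

/-- Independent samples of `P` almost surely have the right frequency in a given set. -/
theorem ae_tendsto_empirical_apply [MeasurableSpace Z] (P : ProbabilityMeasure Z) {s : Set Z}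
    (hs : MeasurableSet s) :
    ∀ᵐ z ∂(Measure.infinitePi fun _ : ℕ ↦ (P : Measure Z)),
      Tendsto (fun n ↦ empirical z n s) atTop (𝓝 (P s)) := by
  have hf : Measurable (s.indicator fun _ ↦ (1 : ℝ)) := measurable_const.indicator hs
  have heval (i : ℕ) := measurePreserving_eval_infinitePi (fun _ : ℕ ↦ (P : Measure Z)) i
  -- Strong law of large numbers for the indicators of `s` evaluated at the i.i.d. coordinates.
  have hslln := ProbabilityTheory.strong_law_ae_real
    (μ := Measure.infinitePi fun _ : ℕ ↦ (P : Measure Z))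
    (fun i z ↦ s.indicator (fun _ ↦ (1 : ℝ)) (z i))
    ((heval 0).integrable_comp_of_integrable ((integrable_const 1).indicator hs))
    (fun i j hij ↦ (ProbabilityTheory.iIndepFun_infinitePi (P := fun _ : ℕ ↦ (P : Measure Z))
      (X := fun _ ↦ s.indicator fun _ ↦ (1 : ℝ)) fun _ ↦ hf).indepFun hij)
    (fun i ↦ ⟨(hf.comp (measurable_pi_apply i)).aemeasurable,
      (hf.comp (measurable_pi_apply 0)).aemeasurable, by
        have (i : ℕ) : (Measure.infinitePi fun _ : ℕ ↦ (P : Measure Z)).map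
            (fun z ↦ s.indicator (fun _ ↦ (1 : ℝ)) (z i)) =
            (P : Measure Z).map (s.indicator fun _ ↦ (1 : ℝ)) := by
          exact (Measure.map_map hf (measurable_pi_apply i)).symm.trans
            (congrArg (Measure.map _) (heval i).map_eq)
        rw [this, this]⟩)
  have hint : ∫ z, s.indicator (fun _ ↦ (1 : ℝ)) (z 0)
      ∂(Measure.infinitePi fun _ : ℕ ↦ (P : Measure Z)) = (P s : ℝ) := by
    rw [← ProbabilityMeasure.measureReal_eq_coe_coeFn, ← integral_indicator_one hs]
    have := integral_map (μ := Measure.infinitePi fun _ : ℕ ↦ (P : Measure Z))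
      (measurable_pi_apply 0).aemeasurable hf.aestronglyMeasurable
    exact this.symm.trans (congrArg (fun ν ↦ ∫ z, s.indicator (fun _ ↦ (1 : ℝ)) z ∂ν)
      (heval 0).map_eq)
  filter_upwards [hslln] with z hz
  rw [← NNReal.tendsto_coe]
  rw [hint] at hz
  -- The shift by one is needed since `empirical z n` averages `n + 1` terms.
  exact ((tendsto_add_atTop_iff_nat 1).2 hz).congr fun n ↦ (coe_empirical_apply z n hs).symm

/-- Every Borel probability measure on a separable metric space has an equidistributed sequence
contained in its support. -/
theorem exists_mem_equidistributed_forall_mem_support [MetricSpace Z] [SecondCountableTopology Z]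
    [MeasurableSpace Z] [BorelSpace Z] (P : ProbabilityMeasure Z) :
    ∃ z ∈ equidistributed P, ∀ i, z i ∈ (P : Measure Z).support := by
  obtain ⟨S, hSc, hSpi, hSo, hSb⟩ := exists_countable_isPiSystem_isTopologicalBasis Z
  have hfreq : ∀ᵐ z ∂(Measure.infinitePi fun _ : ℕ ↦ (P : Measure Z)),
      ∀ s ∈ S, Tendsto (fun n ↦ empirical z n s) atTop (𝓝 (P s)) :=
    (ae_ball_iff hSc).2 fun s hs ↦ ae_tendsto_empirical_apply P (hSo s hs).measurableSet
  have hsupp : ∀ᵐ z ∂(Measure.infinitePi fun _ : ℕ ↦ (P : Measure Z)),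
      ∀ i, z i ∈ (P : Measure Z).support :=
    ae_all_iff.2 fun i ↦ (measurePreserving_eval_infinitePi (fun _ : ℕ ↦ (P : Measure Z))
      i).quasiMeasurePreserving.ae Measure.support_mem_ae
  obtain ⟨z, hz, hz'⟩ := (hfreq.and hsupp).exists
  -- Convergence of masses on a countable π-system of open sets containing a basis already forces
  -- weak convergence; countability made the null sets harmless.
  exact ⟨z, hSpi.tendsto_probabilityMeasure_of_tendsto_of_mem
    (fun s hs ↦ (hSo s hs).measurableSet) hSb hz, hz'⟩

/-- A convergent sequence together with its limit is compact, and relatively compact families on a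
Polish space are tight. -/
theorem isTightMeasureSet_range_empirical [MetricSpace Z] [CompleteSpace Z]
    [SecondCountableTopology Z] [MeasurableSpace Z] [BorelSpace Z] {P : ProbabilityMeasure Z}
    {z : ℕ → Z} (hz : z ∈ equidistributed P) :
    IsTightMeasureSet (Set.range (empiricalMeasure z)) := by
  have hcomp : IsCompact (closure (Set.range (empirical z))) :=
    (Tendsto.isCompact_insert_range hz).closure_of_subset (Set.subset_insert _ _)
  refine (isTightMeasureSet_of_isCompact_closure hcomp).subset ?_
  rintro _ ⟨n, rfl⟩
  exact ⟨empirical z n, Set.mem_range_self n, rfl⟩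

end Empirical

/-! ### Couplings through their marginals -/

section Couplings

variable {X Y : Type*} [MeasurableSpace X] [MeasurableSpace Y]

theorem mem_couplings_iff {μX : ProbabilityMeasure X} {μY : ProbabilityMeasure Y}
    {P : ProbabilityMeasure (X × Y)} :
    P ∈ couplings μX μY ↔ P.map measurable_fst.aemeasurable = μX ∧
      P.map measurable_snd.aemeasurable = μY :=
  and_congr ⟨fun h ↦ Subtype.ext h, fun h ↦ congrArg Subtype.val h⟩
    ⟨fun h ↦ Subtype.ext h, fun h ↦ congrArg Subtype.val h⟩

theorem prod_mem_couplings (μX : ProbabilityMeasure X) (μY : ProbabilityMeasure Y) :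
    μX.prod μY ∈ couplings μX μY := by
  simp [couplings, Measure.map_fst_prod, Measure.map_snd_prod]

end Couplings

/-! ### Semicontinuity of the cost, optimal couplings, and comparison with sequences -/

section Cost

variable {X Y B : Type*} [MetricSpace X] [MetricSpace Y] [MetricSpace B]

theorem sequenceCost_le_iff {πX : X → B} {πY : Y → B} {x : ℕ → X} {y : ℕ → Y} {c : ℝ≥0∞} :
    sequenceCost πX πY x y ≤ c ↔
      (∀ i j, (1 / 2) * ENNReal.ofReal (distortion (x i, y i) (x j, y j)) ≤ c) ∧
        ∀ i, ENNReal.ofReal (fieldDist πX πY (x i, y i)) ≤ c := by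
  simp only [sequenceCost, max_le_iff, ENNReal.mul_iSup, iSup_le_iff]

theorem continuous_distortion :
    Continuous fun w : (X × Y) × X × Y ↦ distortion w.1 w.2 := by
  unfold distortion
  fun_prop

theorem continuous_fieldDist {πX : X → B} {πY : Y → B} (hX : Continuous πX) (hY : Continuous πY) :
    Continuous (fieldDist πX πY) := by
  unfold fieldDist
  fun_prop

variable [MeasurableSpace X] [MeasurableSpace Y]

theorem couplingCost_le_iff {πX : X → B} {πY : Y → B} {P : ProbabilityMeasure (X × Y)} {c : ℝ≥0∞} :
    couplingCost πX πY P ≤ c ↔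
      (∀ z ∈ (P : Measure (X × Y)).support, ∀ z' ∈ (P : Measure (X × Y)).support,
        (1 / 2) * ENNReal.ofReal (distortion z z') ≤ c) ∧
      ∀ z ∈ (P : Measure (X × Y)).support, ENNReal.ofReal (fieldDist πX πY z) ≤ c := by
  simp only [couplingCost, max_le_iff, ENNReal.mul_iSup, iSup_le_iff]
  refine and_congr_left fun _ ↦ ⟨fun h z hz z' hz' ↦ ?_, fun h w hw ↦ ?_⟩
  · exact h (z, z') ((mk_mem_support_prod_self_iff _ z z').2 ⟨hz, hz'⟩)
  · have := (mk_mem_support_prod_self_iff _ w.1 w.2).1 hw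
    exact h _ this.1 _ this.2

theorem sequenceCost_le_couplingCost (πX : X → B) (πY : Y → B) {P : ProbabilityMeasure (X × Y)}
    {z : ℕ → X × Y} (hz : ∀ i, z i ∈ (P : Measure (X × Y)).support) :
    sequenceCost πX πY (Prod.fst ∘ z) (Prod.snd ∘ z) ≤ couplingCost πX πY P := by
  have h := couplingCost_le_iff.1 (le_refl (couplingCost πX πY P))
  exact sequenceCost_le_iff.2 ⟨fun i j ↦ h.1 _ (hz i) _ (hz j), fun i ↦ h.2 _ (hz i)⟩

/-- On bounded fields all couplings have finite cost. -/
theorem couplingCost_lt_top [BoundedSpace X] [BoundedSpace Y] {πX : X → B} {πY : Y → B}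
    (hX : LipschitzWith 1 πX) (hY : LipschitzWith 1 πY) (P : ProbabilityMeasure (X × Y)) :
    couplingCost πX πY P < ∞ := by
  obtain ⟨z₀⟩ := P.nonempty
  obtain ⟨a, ha⟩ := Metric.isBounded_iff.1 (Bornology.IsBounded.all (Set.univ : Set X))
  obtain ⟨b, hb⟩ := Metric.isBounded_iff.1 (Bornology.IsBounded.all (Set.univ : Set Y))
  replace ha (x x' : X) : dist x x' ≤ a := ha (Set.mem_univ x) (Set.mem_univ x')
  replace hb (y y' : Y) : dist y y' ≤ b := hb (Set.mem_univ y) (Set.mem_univ y')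
  have hdist (z z' : X × Y) : distortion z z' ≤ a + b + fieldDist πX πY z₀ := by
    have : 0 ≤ fieldDist πX πY z₀ := dist_nonneg
    refine (abs_sub _ _).trans ?_
    rw [abs_of_nonneg dist_nonneg, abs_of_nonneg dist_nonneg]
    linarith [ha z.1 z'.1, hb z.2 z'.2]
  have hfield (z : X × Y) : fieldDist πX πY z ≤ a + b + fieldDist πX πY z₀ := by
    have h := dist_triangle4 (πX z.1) (πX z₀.1) (πY z₀.2) (πY z.2)
    have h₁ := hX.dist_le_mul z.1 z₀.1
    have h₂ := hY.dist_le_mul z₀.2 z.2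
    simp only [NNReal.coe_one, one_mul] at h₁ h₂
    unfold fieldDist
    linarith [ha z.1 z₀.1, hb z₀.2 z.2]
  refine lt_of_le_of_lt (couplingCost_le_iff.2 ⟨fun z _ z' _ ↦ ?_, fun z _ ↦ ?_⟩)
    (ENNReal.ofReal_lt_top (r := a + b + fieldDist πX πY z₀))
  · refine (mul_le_of_le_one_left' (by simp)).trans (ENNReal.ofReal_le_ofReal (hdist z z'))
  · exact ENNReal.ofReal_le_ofReal (hfield z)

theorem couplingCost_empirical_le [BorelSpace X] [BorelSpace Y]
    [SecondCountableTopology Y] (πX : X → B) (πY : Y → B) (x : ℕ → X) (y : ℕ → Y) (n : ℕ) :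
    couplingCost πX πY (empirical (fun i ↦ (x i, y i)) n) ≤ sequenceCost πX πY x y := by
  have h := sequenceCost_le_iff.1 (le_refl (sequenceCost πX πY x y))
  have hsupp := support_empirical_subset_range (fun i ↦ (x i, y i)) n
  refine couplingCost_le_iff.2 ⟨fun z hz z' hz' ↦ ?_, fun z hz ↦ ?_⟩
  · obtain ⟨i, rfl⟩ := hsupp hz
    obtain ⟨j, rfl⟩ := hsupp hz'
    exact h.1 i j
  · obtain ⟨i, rfl⟩ := hsupp hz
    exact h.2 i

variable [BorelSpace X] [SecondCountableTopology X] [BorelSpace Y] [SecondCountableTopology Y]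

theorem lowerSemicontinuous_couplingCost {πX : X → B} {πY : Y → B} (hX : Continuous πX)
    (hY : Continuous πY) : LowerSemicontinuous (couplingCost πX πY) := by
  rw [lowerSemicontinuous_iff_isClosed_preimage]
  intro c
  have h₁ : IsClosed {w : (X × Y) × X × Y | (1 / 2) * ENNReal.ofReal (distortion w.1 w.2) ≤ c} :=
    isClosed_le ((ENNReal.continuous_const_mul (by simp)).comp
      (ENNReal.continuous_ofReal.comp continuous_distortion)) continuous_const
  -- The one-point condition is posed on pairs, ignoring the second point, so that the closedness
  -- lemma for squares of supports applies to it too.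
  have h₂ : IsClosed {w : (X × Y) × X × Y | ENNReal.ofReal (fieldDist πX πY w.1) ≤ c} :=
    isClosed_le (ENNReal.continuous_ofReal.comp
      ((continuous_fieldDist hX hY).comp continuous_fst)) continuous_const
  convert (isClosed_setOf_support_prod_subset h₁).inter
    (isClosed_setOf_support_prod_subset h₂) using 1
  ext P
  simp only [Set.mem_preimage, Set.mem_Iic, couplingCost_le_iff, Set.mem_inter_iff,
    Set.mem_ofPred_eq]
  exact and_congr_right fun _ ↦ ⟨fun h z hz _ _ ↦ h z hz, fun h z hz ↦ h z hz z hz⟩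

/-- Prokhorov: couplings share two fixed marginals, each tight, so they are jointly tight;
continuity of pushforward makes the set closed. -/
theorem isCompact_couplings [CompleteSpace X] [CompleteSpace Y] (μX : ProbabilityMeasure X)
    (μY : ProbabilityMeasure Y) : IsCompact (couplings μX μY) := by
  have hclosed : IsClosed (couplings μX μY) := by
    simp only [Set.ext fun P ↦ mem_couplings_iff (μX := μX) (μY := μY) (P := P)]
    exact (isClosed_eq (ProbabilityMeasure.continuous_map continuous_fst) continuous_const).inter
      (isClosed_eq (ProbabilityMeasure.continuous_map continuous_snd) continuous_const)
  rw [← hclosed.closure_eq]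
  refine isCompact_closure_of_isTightMeasureSet (IsTightMeasureSet.prodMk ?_ ?_)
  · refine (isTightMeasureSet_singleton (μ := (μX : Measure X))).subset ?_
    rintro _ ⟨_, ⟨P, hP, rfl⟩, rfl⟩
    exact hP.1
  · refine (isTightMeasureSet_singleton (μ := (μY : Measure Y))).subset ?_
    rintro _ ⟨_, ⟨P, hP, rfl⟩, rfl⟩
    exact hP.2

theorem exists_couplingCost_eq_gwInfDist [CompleteSpace X] [CompleteSpace Y] {πX : X → B}
    {πY : Y → B} (hX : Continuous πX) (hY : Continuous πY) (μX : ProbabilityMeasure X)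
    (μY : ProbabilityMeasure Y) :
    ∃ P ∈ couplings μX μY, couplingCost πX πY P = gwInfDist πX πY μX μY := by
  obtain ⟨P, hP, hmin⟩ := LowerSemicontinuousOn.exists_isMinOn
    ⟨_, prod_mem_couplings μX μY⟩ (isCompact_couplings μX μY)
    ((lowerSemicontinuous_couplingCost hX hY).lowerSemicontinuousOn _)
  exact ⟨P, hP, le_antisymm (le_iInf₂ fun Q hQ ↦ hmin hQ) (iInf₂_le P hP)⟩

theorem gwInfDist_le_sequenceCost [CompleteSpace X] [CompleteSpace Y] {πX : X → B} {πY : Y → B}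
    (hX : Continuous πX) (hY : Continuous πY) {μX : ProbabilityMeasure X}
    {μY : ProbabilityMeasure Y} {x : ℕ → X} {y : ℕ → Y} (hx : x ∈ equidistributed μX)
    (hy : y ∈ equidistributed μY) :
    gwInfDist πX πY μX μY ≤ sequenceCost πX πY x y := by
  set z : ℕ → X × Y := fun i ↦ (x i, y i) with hz
  have hcomp : IsCompact (closure (Set.range (empirical z))) := by
    refine isCompact_closure_of_isTightMeasureSet (IsTightMeasureSet.prodMk ?_ ?_)
    · refine (isTightMeasureSet_range_empirical hx).subset ?_
      rintro _ ⟨_, ⟨_, ⟨n, rfl⟩, rfl⟩, rfl⟩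
      exact ⟨n, (map_empiricalMeasure measurable_fst z n).symm⟩
    · refine (isTightMeasureSet_range_empirical hy).subset ?_
      rintro _ ⟨_, ⟨_, ⟨n, rfl⟩, rfl⟩, rfl⟩
      exact ⟨n, (map_empiricalMeasure measurable_snd z n).symm⟩
  obtain ⟨P, -, φ, hφ, hP⟩ :=
    hcomp.isSeqCompact fun n ↦ subset_closure (Set.mem_range_self (f := empirical z) n)
  have hPmem : P ∈ couplings μX μY := by
    refine mem_couplings_iff.2 ⟨?_, ?_⟩
    · refine tendsto_nhds_unique
        (((ProbabilityMeasure.continuous_map continuous_fst).tendsto P).comp hP) ?_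
      exact (Tendsto.comp hx hφ.tendsto_atTop).congr fun n ↦
        (map_empirical measurable_fst z (φ n)).symm
    · refine tendsto_nhds_unique
        (((ProbabilityMeasure.continuous_map continuous_snd).tendsto P).comp hP) ?_
      exact (Tendsto.comp hy hφ.tendsto_atTop).congr fun n ↦
        (map_empirical measurable_snd z (φ n)).symm
  refine (iInf₂_le P hPmem).trans ?_
  have hclosed := lowerSemicontinuous_iff_isClosed_preimage.1
    (lowerSemicontinuous_couplingCost hX hY) (sequenceCost πX πY x y)
  -- Every empirical measure lies in the closed sublevel set at the sequence cost, because its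
  -- support consists of points of the sequence.
  exact hclosed.mem_of_tendsto hP
    (Eventually.of_forall fun n ↦ couplingCost_empirical_le πX πY x y (φ n))

theorem exists_sequenceCost_le_gwInfDist [CompleteSpace X] [CompleteSpace Y] {πX : X → B}
    {πY : Y → B} (hX : Continuous πX) (hY : Continuous πY) (μX : ProbabilityMeasure X)
    (μY : ProbabilityMeasure Y) :
    ∃ x ∈ equidistributed μX, ∃ y ∈ equidistributed μY,
      sequenceCost πX πY x y ≤ gwInfDist πX πY μX μY := by
  obtain ⟨P, hP, hcost⟩ := exists_couplingCost_eq_gwInfDist hX hY μX μY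
  obtain ⟨z, hz, hsupp⟩ := exists_mem_equidistributed_forall_mem_support P
  have hP' := mem_couplings_iff.1 hP
  refine ⟨Prod.fst ∘ z, ?_, Prod.snd ∘ z, ?_, hcost ▸ sequenceCost_le_couplingCost πX πY hsupp⟩
  · exact hP'.1 ▸ comp_mem_equidistributed continuous_fst hz
  · exact hP'.2 ▸ comp_mem_equidistributed continuous_snd hz

end Cost

end MMField

theorem mainTheorem9
    {X Y B : Type*}
    [MetricSpace X] [CompleteSpace X] [TopologicalSpace.SeparableSpace X]
    [MeasurableSpace X] [BorelSpace X] [BoundedSpace X]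
    [MetricSpace Y] [CompleteSpace Y] [TopologicalSpace.SeparableSpace Y]
    [MeasurableSpace Y] [BorelSpace Y] [BoundedSpace Y]
    [MetricSpace B] [CompleteSpace B] [TopologicalSpace.SeparableSpace B]
    (πX : X → B) (hπX : LipschitzWith 1 πX)
    (πY : Y → B) (hπY : LipschitzWith 1 πY)
    (μX : ProbabilityMeasure X) (μY : ProbabilityMeasure Y) :
    MMField.gwInfDist πX πY μX μY < ∞ ∧
    MMField.gwInfDist πX πY μX μY =
      (⨅ x ∈ MMField.equidistributed μX, ⨅ y ∈ MMField.equidistributed μY,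
        MMField.sequenceCost πX πY x y) ∧
    ∃ x ∈ MMField.equidistributed μX, ∃ y ∈ MMField.equidistributed μY,
      MMField.sequenceCost πX πY x y =
        ⨅ x' ∈ MMField.equidistributed μX, ⨅ y' ∈ MMField.equidistributed μY,
          MMField.sequenceCost πX πY x' y' := by
  have := UniformSpace.secondCountable_of_separable X
  have := UniformSpace.secondCountable_of_separable Y
  have hle : MMField.gwInfDist πX πY μX μY ≤ ⨅ x ∈ MMField.equidistributed μX,
      ⨅ y ∈ MMField.equidistributed μY, MMField.sequenceCost πX πY x y :=
    le_iInf₂ fun x hx ↦ le_iInf₂ fun y hy ↦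
      MMField.gwInfDist_le_sequenceCost hπX.continuous hπY.continuous hx hy
  obtain ⟨x, hx, y, hy, hxy⟩ :=
    MMField.exists_sequenceCost_le_gwInfDist hπX.continuous hπY.continuous μX μY
  have hinf : (⨅ x ∈ MMField.equidistributed μX, ⨅ y ∈ MMField.equidistributed μY,
      MMField.sequenceCost πX πY x y) ≤ MMField.sequenceCost πX πY x y :=
    (iInf₂_le x hx).trans (iInf₂_le y hy)
  refine ⟨?_, le_antisymm hle (hinf.trans hxy), x, hx, y, hy, le_antisymm (hxy.trans hle) hinf⟩
  exact (iInf₂_le _ (MMField.prod_mem_couplings μX μY)).trans_lt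
    (MMField.couplingCost_lt_top hπX hπY _)
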